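/- Let $E$ be a real inner product space. On $E\times E\times\mathbb R$ consider the Heisenberg group law $$(x,y,z)\cdot(x',y',z')=\Bigl(x+x',\,y+y',\,z+z'+\tfrac12\bigl(\langle x,y'\rangle-\langle x',y\rangle\bigr)\Bigr),$$ the Koranyi norm $N(x,y,z)=\bigl((|x|^2+|y|^2)^2+z^2\bigr)^{1/4}$ and the left-invariant Koranyi metric $d(g,h)=N(g^{-1}h)$. For $E=\mathbb R$ this is the three-dimensional Heisenberg group $\mathbb H_1$; for $E=\ell_2$ it is the infinite-dimensional Heisenberg group $\mathbb H_\infty$. On $\mathbb H_1$ consider also the Carnot–Carathéodory distance $d_{cc}(g,h)$, the infimum of $\int_a^b\sqrt{|\gamma_x'(t)|^2+|\gamma_y'(t)|^2}\,dt$ over all $C^1$ curves $\gamma=(\gamma_x,\gamma_y,\gamma_z):[a,b]\to\mathbb H_1$, $a<b$, from $g$ to $h$ that are horizontal, that is, $\gamma_z'=\tfrac12(\gamma_x\gamma_y'-\gamma_x'\gamma_y)$. For a Markov chain $(Z_t)_{t\in\mathbb Z}$ (with countable state space $\Omega$ and possibly time-dependent transition probabilities) and $s\in\mathbb Z$, let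 $(\tilde Z_t(s))_{t\in\mathbb Z}$ be the process that equals $Z_t$ for $t\le s$ and evolves independently of $Z$, with the same transition probabilities, for $t>s$. For $p>0$, a metric space $(X,d_X)$ is called Markov $p$-convex if there is $\Pi>0$ such that for every such Markov chain and every $f:\Omega\to X$, $$\sum_{k=0}^\infty\sum_{t\in\mathbb Z}\frac{\mathbb E\bigl[d_X\bigl(f(Z_t),f(\tilde Z_t(t-2^k))\bigr)^p\bigr]}{2^{kp}}\le\Pi^p\sum_{t\in\mathbb Z}\mathbb E\bigl[d_X(f(Z_t),f(Z_{t-1}))^p\bigr],$$ where both sides take values in $[0,\infty]$. Then for every $p\in(0,4)$, $\mathbb H_1$ is not Markov $p$-convex, neither with the Koranyi metric $d$ nor with the Carnot–Carathéodory metric $d_{cc}$, and $\mathbb H_\infty$ with the Koranyi metric is not Markov $p$-convex. -/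

import Mathlib

open MeasureTheory
open scoped ENNReal NNReal RealInnerProductSpace

/-- The Heisenberg group modelled on a real inner product space `E`: the set `E × E × ℝ` with
the group law given below. For `E = ℝⁿ` it is the `(2n+1)`-dimensional group `ℍ_n`, for `E = ℓ₂`
it is `ℍ_∞`. -/
@[ext]
structure Heisenberg (E : Type*) where
  x : E
  y : E
  z : ℝ

namespace Heisenberg

section Algebra

set_option linter.unusedSectionVars false

variable {E : Type*} [NormedAddCommGroup E] [InnerProductSpace ℝ E]

noncomputable instance : Mul (Heisenberg E) :=
  ⟨fun g h => ⟨g.x + h.x, g.y + h.y, g.z + h.z + (1 / 2) * (⟪g.x, h.y⟫ - ⟪h.x, g.y⟫)⟩⟩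

instance : One (Heisenberg E) := ⟨⟨0, 0, 0⟩⟩

instance : Inv (Heisenberg E) := ⟨fun g => ⟨-g.x, -g.y, -g.z⟩⟩

@[simp] theorem mul_x (g h : Heisenberg E) : (g * h).x = g.x + h.x := rfl
@[simp] theorem mul_y (g h : Heisenberg E) : (g * h).y = g.y + h.y := rfl
@[simp] theorem mul_z (g h : Heisenberg E) :
    (g * h).z = g.z + h.z + (1 / 2) * (⟪g.x, h.y⟫ - ⟪h.x, g.y⟫) := rfl
@[simp] theorem one_x : (1 : Heisenberg E).x = 0 := rfl
@[simp] theorem one_y : (1 : Heisenberg E).y = 0 := rfl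
@[simp] theorem one_z : (1 : Heisenberg E).z = 0 := rfl
@[simp] theorem inv_x (g : Heisenberg E) : (g⁻¹).x = -g.x := rfl
@[simp] theorem inv_y (g : Heisenberg E) : (g⁻¹).y = -g.y := rfl
@[simp] theorem inv_z (g : Heisenberg E) : (g⁻¹).z = -g.z := rfl

noncomputable instance : Group (Heisenberg E) :=
  Group.ofLeftAxioms
    (by
      intro a b c
      ext
      · simp [add_assoc]
      · simp [add_assoc]
      · simp only [mul_x, mul_y, mul_z, inner_add_left, inner_add_right]; ring)
    (by intro a; ext <;> simp)
    (by
      intro a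
      ext
      · simp
      · simp
      · simp [inner_neg_left, inner_neg_right])

/-- The Koranyi norm `N(x, y, z) = ((|x|² + |y|²)² + z²)^{1/4}`. -/
noncomputable def koranyiNorm (g : Heisenberg E) : ℝ :=
  ((‖g.x‖ ^ 2 + ‖g.y‖ ^ 2) ^ 2 + g.z ^ 2) ^ (1 / 4 : ℝ)

theorem koranyiNorm_nonneg (g : Heisenberg E) : 0 ≤ koranyiNorm g := by
  unfold koranyiNorm; positivity

theorem koranyiNorm_pow_four (g : Heisenberg E) :
    koranyiNorm g ^ 4 = (‖g.x‖ ^ 2 + ‖g.y‖ ^ 2) ^ 2 + g.z ^ 2 := by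
  unfold koranyiNorm
  rw [← Real.rpow_natCast, ← Real.rpow_mul (by positivity)]
  norm_num

theorem koranyiNorm_inv (g : Heisenberg E) : koranyiNorm g⁻¹ = koranyiNorm g := by
  simp [koranyiNorm]

theorem koranyiNorm_one : koranyiNorm (1 : Heisenberg E) = 0 := by
  simp [koranyiNorm]

theorem eq_one_of_koranyiNorm_eq_zero {g : Heisenberg E} (hg : koranyiNorm g = 0) : g = 1 := by
  have h := koranyiNorm_pow_four g
  rw [hg] at h
  have hz : g.z = 0 := by nlinarith [sq_nonneg (‖g.x‖ ^ 2 + ‖g.y‖ ^ 2), sq_nonneg g.z]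
  have hs : ‖g.x‖ ^ 2 + ‖g.y‖ ^ 2 = 0 := by
    nlinarith [sq_nonneg (‖g.x‖ ^ 2 + ‖g.y‖ ^ 2), sq_nonneg g.z]
  have hx : ‖g.x‖ = 0 := by nlinarith [sq_nonneg ‖g.x‖, sq_nonneg ‖g.y‖]
  have hy : ‖g.y‖ = 0 := by nlinarith [sq_nonneg ‖g.x‖, sq_nonneg ‖g.y‖]
  ext
  · simpa using hx
  · simpa using hy
  · simpa using hz

theorem inner_sq_add_symplectic_sq_le (a b c d : E) :
    (⟪a, c⟫ + ⟪b, d⟫) ^ 2 + (⟪a, d⟫ - ⟪c, b⟫) ^ 2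
      ≤ (‖a‖ ^ 2 + ‖b‖ ^ 2) * (‖c‖ ^ 2 + ‖d‖ ^ 2) := by
  set A := ‖a‖ ^ 2 + ‖b‖ ^ 2 with hA
  set B := ‖c‖ ^ 2 + ‖d‖ ^ 2 with hB
  set P := ⟪a, c⟫ + ⟪b, d⟫ with hP
  set W := ⟪a, d⟫ - ⟪c, b⟫ with hW
  have key : ‖A • c - P • a + W • b‖ ^ 2 + ‖A • d - P • b - W • a‖ ^ 2
      = A * (A * B - P ^ 2 - W ^ 2) := by
    simp only [← real_inner_self_eq_norm_sq, inner_add_left, inner_add_right, inner_sub_left,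
      inner_sub_right, real_inner_smul_left, real_inner_smul_right]
    rw [real_inner_comm a c, real_inner_comm b d, real_inner_comm a d, real_inner_comm b c,
      real_inner_comm a b]
    have hA' : A = ⟪a, a⟫ + ⟪b, b⟫ := by simp only [hA, real_inner_self_eq_norm_sq]
    have hB' : B = ⟪c, c⟫ + ⟪d, d⟫ := by simp only [hB, real_inner_self_eq_norm_sq]
    have hW' : W = ⟪a, d⟫ - ⟪b, c⟫ := by rw [hW, real_inner_comm b c]
    rw [hA', hB', hW', hP]
    ring
  have h0 : 0 ≤ A * (A * B - P ^ 2 - W ^ 2) := by rw [← key]; positivity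
  rcases (show 0 ≤ A by positivity).eq_or_lt with h | h
  · have ha : a = 0 := by
      have : ‖a‖ = 0 := by nlinarith [sq_nonneg ‖a‖, sq_nonneg ‖b‖]
      simpa using this
    have hb : b = 0 := by
      have : ‖b‖ = 0 := by nlinarith [sq_nonneg ‖a‖, sq_nonneg ‖b‖]
      simpa using this
    simp [hP, hW, hA, ha, hb]
  · have := nonneg_of_mul_nonneg_right h0 h
    linarith

theorem koranyiNorm_mul_le (g h : Heisenberg E) :
    koranyiNorm (g * h) ≤ koranyiNorm g + koranyiNorm h := by
  have hsq : ∀ k : Heisenberg E,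
      koranyiNorm k ^ 2 = ‖(⟨‖k.x‖ ^ 2 + ‖k.y‖ ^ 2, k.z⟩ : ℂ)‖ := by
    intro k
    rw [← sq_eq_sq₀ (by positivity) (norm_nonneg _), ← Complex.normSq_eq_norm_sq,
      Complex.normSq_mk, ← pow_mul, koranyiNorm_pow_four]
    ring
  have hg := koranyiNorm_nonneg g
  have hh := koranyiNorm_nonneg h
  have hP : ‖(⟨2 * (⟪g.x, h.x⟫ + ⟪g.y, h.y⟫), (1 / 2) * (⟪g.x, h.y⟫ - ⟪h.x, g.y⟫)⟩ : ℂ)‖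
      ≤ 2 * (koranyiNorm g * koranyiNorm h) := by
    rw [← sq_le_sq₀ (norm_nonneg _) (by positivity), ← Complex.normSq_eq_norm_sq,
      Complex.normSq_mk]
    have h1 := inner_sq_add_symplectic_sq_le g.x g.y h.x h.y
    have h2 : ∀ k : Heisenberg E, ‖k.x‖ ^ 2 + ‖k.y‖ ^ 2 ≤ koranyiNorm k ^ 2 := by
      intro k
      rw [hsq k]
      exact Complex.re_le_norm (⟨‖k.x‖ ^ 2 + ‖k.y‖ ^ 2, k.z⟩ : ℂ)
    have h3 : (‖g.x‖ ^ 2 + ‖g.y‖ ^ 2) * (‖h.x‖ ^ 2 + ‖h.y‖ ^ 2)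
        ≤ koranyiNorm g ^ 2 * koranyiNorm h ^ 2 :=
      mul_le_mul (h2 g) (h2 h) (by positivity) (by positivity)
    nlinarith [sq_nonneg (⟪g.x, h.y⟫ - ⟪h.x, g.y⟫)]
  have hsum : (⟨‖(g * h).x‖ ^ 2 + ‖(g * h).y‖ ^ 2, (g * h).z⟩ : ℂ)
      = ⟨‖g.x‖ ^ 2 + ‖g.y‖ ^ 2, g.z⟩ + ⟨‖h.x‖ ^ 2 + ‖h.y‖ ^ 2, h.z⟩
        + ⟨2 * (⟪g.x, h.x⟫ + ⟪g.y, h.y⟫), (1 / 2) * (⟪g.x, h.y⟫ - ⟪h.x, g.y⟫)⟩ := by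
    apply Complex.ext
    · simp only [Complex.add_re, mul_x, mul_y, norm_add_sq_real]; ring
    · simp only [Complex.add_im, mul_z]
  have hfin : koranyiNorm (g * h) ^ 2 ≤ (koranyiNorm g + koranyiNorm h) ^ 2 := by
    rw [hsq (g * h), hsum]
    refine (norm_add₃_le).trans ?_
    rw [← hsq g, ← hsq h]
    nlinarith
  exact (sq_le_sq₀ (koranyiNorm_nonneg _) (by positivity)).1 hfin

/-- The Koranyi metric `d(g, h) = N(g⁻¹ h)`. -/
noncomputable instance : MetricSpace (Heisenberg E) where
  dist g h := koranyiNorm (g⁻¹ * h)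
  dist_self g := by simp [koranyiNorm_one]
  dist_comm g h := by
    rw [← koranyiNorm_inv (g⁻¹ * h)]
    simp
  dist_triangle g h k := by
    have := koranyiNorm_mul_le (g⁻¹ * h) (h⁻¹ * k)
    simpa [mul_assoc] using this
  eq_of_dist_eq_zero {g h} hgh := (inv_mul_eq_one.1 (eq_one_of_koranyiNorm_eq_zero hgh))

theorem dist_def (g h : Heisenberg E) : dist g h = koranyiNorm (g⁻¹ * h) := rfl

/-- `γ : [a, b] → Heisenberg E` is of class `C¹` and horizontal: its velocity at each time lies in
the left translate to `γ t` of the plane `E × E × {0}`, whose elements at `(x, y, z)` are the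
vectors `(u, v, (⟪x, v⟫ - ⟪u, y⟫) / 2)`. -/
structure IsHorizontalCurve (γ : ℝ → Heisenberg E) (a b : ℝ) : Prop where
  contDiffOn_x : ContDiffOn ℝ 1 (fun t => (γ t).x) (Set.Icc a b)
  contDiffOn_y : ContDiffOn ℝ 1 (fun t => (γ t).y) (Set.Icc a b)
  contDiffOn_z : ContDiffOn ℝ 1 (fun t => (γ t).z) (Set.Icc a b)
  horizontal : ∀ t ∈ Set.Icc a b,
    derivWithin (fun s => (γ s).z) (Set.Icc a b) t
      = (1 / 2) * (⟪(γ t).x, derivWithin (fun s => (γ s).y) (Set.Icc a b) t⟫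
          - ⟪derivWithin (fun s => (γ s).x) (Set.Icc a b) t, (γ t).y⟫)

/-- The length of a horizontal curve for the left-invariant scalar product which is the standard
one of `E × E` at the origin. -/
noncomputable def horizontalLength (γ : ℝ → Heisenberg E) (a b : ℝ) : ℝ :=
  ∫ t in a..b, Real.sqrt (‖derivWithin (fun s => (γ s).x) (Set.Icc a b) t‖ ^ 2
    + ‖derivWithin (fun s => (γ s).y) (Set.Icc a b) t‖ ^ 2)

/-- The Carnot–Carathéodory distance: the infimum of the lengths of the `C¹` horizontal curves
from `g` to `h` (with value `∞` if there were none). -/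
noncomputable def ccDist (g h : Heisenberg E) : ℝ≥0∞ :=
  ⨅ (γ : ℝ → Heisenberg E) (a : ℝ) (b : ℝ) (_ : a < b) (_ : IsHorizontalCurve γ a b)
    (_ : γ a = g) (_ : γ b = h), ENNReal.ofReal (horizontalLength γ a b)

end Algebra

end Heisenberg

/-- The three-dimensional Heisenberg group. -/
abbrev HeisenbergOne : Type := Heisenberg (EuclideanSpace ℝ (Fin 1))

/-- The infinite-dimensional Heisenberg group, modelled on the real sequence space `ℓ₂`. -/
abbrev HeisenbergInfty : Type := Heisenberg (lp (fun _ : ℕ => ℝ) 2)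

section MarkovConvexity

/-- `(Z_t)_{t ∈ ℤ}` is a Markov chain on `Ω` with transition probabilities
`P t v w = ℙ(Z_{t+1} = w | Z_t = v)`, defined on the probability space `(S, μ)`: conditionally on
`Z_r, …, Z_t`, the law of `Z_{t+1}` is `P t (Z_t)`. -/
structure IsMarkovChain {S Ω : Type*} [MeasurableSpace S] (μ : Measure S)
    (P : ℤ → Ω → PMF Ω) (Z : ℤ → S → Ω) : Prop where
  measurable : ∀ t v, MeasurableSet {ω | Z t ω = v}
  markov : ∀ r t : ℤ, r ≤ t → ∀ v : ℤ → Ω,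
    μ {ω | ∀ u ∈ Set.Icc r (t + 1), Z u ω = v u}
      = μ {ω | ∀ u ∈ Set.Icc r t, Z u ω = v u} * P t (v t) (v (t + 1))

/-- `Z'` equals the chain `Z` up to time `s` and then evolves independently of `Z`, with the same
transition probabilities: conditionally on any finite stretch `Z_r, …, Z_q` of the chain `Z`
(past and future) and on `Z'_s, …, Z'_t`, where `t ≥ s`, the law of `Z'_{t+1}` is `P t (Z'_t)`. -/
structure IsBranchedCopy {S Ω : Type*} [MeasurableSpace S] (μ : Measure S)
    (P : ℤ → Ω → PMF Ω) (Z : ℤ → S → Ω) (s : ℤ) (Z' : ℤ → S → Ω) : Prop where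
  measurable : ∀ t v, MeasurableSet {ω | Z' t ω = v}
  eq_of_le : ∀ t ≤ s, Z' t = Z t
  branch : ∀ r q t : ℤ, s ≤ t → ∀ v w : ℤ → Ω,
    μ {ω | (∀ u ∈ Set.Icc r q, Z u ω = v u) ∧ ∀ u ∈ Set.Icc s (t + 1), Z' u ω = w u}
      = μ {ω | (∀ u ∈ Set.Icc r q, Z u ω = v u) ∧ ∀ u ∈ Set.Icc s t, Z' u ω = w u}
        * P t (w t) (w (t + 1))

/-- The distance `d` on `X` is Markov `p`-convex. Markov chains have a countable state space and
transition probabilities that may depend on time; `Z' s` is the process written `Z̃(s)`. All sums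
and expectations are taken in `[0, ∞]`. -/
def IsMarkovConvexDist {X : Type*} (d : X → X → ℝ≥0∞) (p : ℝ) : Prop :=
  ∃ K : ℝ≥0, 0 < K ∧
    ∀ (Ω : Type) [Countable Ω] (S : Type) [MeasurableSpace S] (μ : Measure S)
      [IsProbabilityMeasure μ] (P : ℤ → Ω → PMF Ω) (Z : ℤ → S → Ω) (Z' : ℤ → ℤ → S → Ω),
      IsMarkovChain μ P Z → (∀ s, IsBranchedCopy μ P Z s (Z' s)) →
      ∀ f : Ω → X,
        ∑' (k : ℕ) (t : ℤ),
            (∫⁻ ω, d (f (Z t ω)) (f (Z' (t - 2 ^ k) t ω)) ^ p ∂μ) / (2 : ℝ≥0∞) ^ ((k : ℝ) * p)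
          ≤ (K : ℝ≥0∞) ^ p * ∑' t : ℤ, ∫⁻ ω, d (f (Z t ω)) (f (Z (t - 1) ω)) ^ p ∂μ

/-- The metric space `X` is Markov `p`-convex. -/
def MarkovConvex (X : Type*) [MetricSpace X] (p : ℝ) : Prop :=
  IsMarkovConvexDist (fun a b : X => edist a b) p

end MarkovConvexity

/-! The obstruction is a random horizontal path that carries fresh randomness at `n` dyadic scales
at once. The path moves to the right at unit speed over a planar graph; its slope at time `u` is
`n^(-1/2)` times the sum over `j < n` of independent signs attached to the dyadic blocks of length
`2^j` containing `u`. Since the signs are independent, the slope has bounded fourth moment, so each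
step has bounded `p`-th moment for `p < 4`, uniformly in `n` (`sum_dist_step_le`).

Branch the process at time `t - 2^(j+1)`. The last complete block of length `2^j` before `t` is then
resampled. Flipping its sign changes the area below the graph by at least `n^(-1/2) 4^j`, and at
equal times the `z`-coordinate of `g⁻¹h` is exactly the difference of areas. Hence the two branches
are typically at distance at least of order `n^(-1/4) 2^j` (`card_mul_le_sum_dist_branch`), and each
of the `n` scales contributes a multiple of `n^(-p/4)` per unit of time to the left side. Markov
convexity would bound `n^(1 - p/4)`, which is false for large `n` when `p < 4`.

Of the metric only two properties matter: its square dominates `|z(g⁻¹h)|`, and a horizontal step of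
slope `a` costs at most `√(1 + a²)`. Both the Koranyi and the Carnot–Carathéodory distances have
them (`not_isMarkovConvexDist`). -/

section RandomWalk

/-! ### Chains of noise histories and their branched copies on a finite probability space -/

variable {B : Type} {T : ℕ}

/-- The sequence whose `i`-th term, for `i < T`, is read from the copy `c i` of the noise `ω`. -/
def noiseSeq [One B] (c : ℕ → Bool) (ω : Bool × Fin T → B) (i : ℕ) : B :=
  if h : i < T then ω (c i, ⟨i, h⟩) else 1

/-- The first `m` terms of `noiseSeq c ω`. -/
def noisePath [One B] (c : ℕ → Bool) (m : ℕ) (ω : Bool × Fin T → B) : List B :=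
  (List.range m).map (noiseSeq c ω)

theorem noisePath_succ [One B] (c : ℕ → Bool) (m : ℕ) (ω : Bool × Fin T → B) :
    noisePath c (m + 1) ω = noisePath c m ω ++ [noiseSeq c ω m] := by
  simp [noisePath, List.range_succ]

theorem noisePath_congr [One B] {c c' : ℕ → Bool} {m : ℕ} {ω ω' : Bool × Fin T → B}
    (h : ∀ i < m, noiseSeq c ω i = noiseSeq c' ω' i) : noisePath c m ω = noisePath c' m ω' := by
  refine List.map_congr_left fun i hi => h i (List.mem_range.1 hi)

theorem noiseSeq_mul_mulSingle [Group B] (c : ℕ → Bool) (ω : Bool × Fin T → B) (i : ℕ) (b : B)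
    (κ : Bool) (k : Fin T) (h : (c i, i) ≠ (κ, (k : ℕ))) :
    noiseSeq c (ω * Pi.mulSingle (κ, k) b) i = noiseSeq c ω i := by
  unfold noiseSeq
  split_ifs with hi
  · have : (c i, (⟨i, hi⟩ : Fin T)) ≠ (κ, k) := by
      intro h'
      apply h
      rw [Prod.mk.injEq] at h' ⊢
      exact ⟨h'.1, by rw [← h'.2]⟩
    simp [Pi.mulSingle_eq_of_ne this]
  · rfl

/-- The time `t`, clamped to `[0, T]`. -/
def clampTime (T : ℕ) (t : ℤ) : ℕ := min t.toNat T

/-- Append a uniformly distributed term at the times `0, …, T - 1`, do nothing at other times. -/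
noncomputable def appendKernel (B : Type) [Fintype B] [Nonempty B] (T : ℕ) (t : ℤ) (l : List B) :
    PMF (List B) :=
  if 0 ≤ t ∧ t < T then (PMF.uniformOfFintype B).map (fun b => l ++ [b]) else PMF.pure l

/-- The indices at which the copy that branches at time `s` reads the second copy of the noise. -/
def branchSelector (s : ℤ) (i : ℕ) : Bool := decide (s ≤ i)

/-- The uniform probability measure on a finite type, for the discrete `σ`-algebra. -/
noncomputable def uniformMeasure (S : Type*) [Fintype S] [Nonempty S] : @Measure S ⊤ :=
  @PMF.toMeasure S ⊤ (PMF.uniformOfFintype S)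

theorem uniformMeasure_apply {S : Type*} [Fintype S] [Nonempty S] (A : Set S) :
    uniformMeasure S A = (Nat.card A : ℝ≥0∞) / Fintype.card S := by
  classical
  let _ : MeasurableSpace S := ⊤
  rw [uniformMeasure, PMF.toMeasure_uniformOfFintype_apply A trivial, Nat.card_eq_fintype_card]

theorem uniformMeasure_preimage {S : Type*} [Fintype S] [Nonempty S] (e : S ≃ S) (A : Set S) :
    uniformMeasure S (e ⁻¹' A) = uniformMeasure S A := by
  rw [uniformMeasure_apply, uniformMeasure_apply]
  congr 2
  exact Nat.card_congr (e.subtypeEquiv fun _ => Iff.rfl)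

theorem lintegral_uniformMeasure {S : Type*} [Fintype S] [Nonempty S] (g : S → ℝ≥0∞) :
    @lintegral S ⊤ (uniformMeasure S) g = (∑ ω, g ω) / Fintype.card S := by
  let _ : MeasurableSpace S := ⊤
  rw [lintegral_fintype, div_eq_mul_inv, Finset.sum_mul]
  refine Finset.sum_congr rfl fun ω _ => ?_
  rw [uniformMeasure_apply]
  simp

variable [Group B] [Fintype B]

/-- An event invariant under multiplication of coordinate `i` is independent of that coordinate:
multiplication permutes the slices `ω i = b'`, which therefore have equal measure. This is where a
group structure on the noise is used. -/
theorem uniformMeasure_inter_coord {ι : Type*} [Fintype ι] [DecidableEq ι] (i : ι)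
    (A : Set (ι → B)) (hA : ∀ ω b, ω ∈ A → ω * Pi.mulSingle i b ∈ A) (b : B) :
    uniformMeasure (ι → B) (A ∩ {ω | ω i = b})
      = uniformMeasure (ι → B) A * PMF.uniformOfFintype B b := by
  classical
  let _ : MeasurableSpace (ι → B) := ⊤
  have hA' : ∀ ω b, ω * Pi.mulSingle i b ∈ A ↔ ω ∈ A := fun ω b =>
    ⟨fun h => by simpa [mul_assoc, ← Pi.mulSingle_mul] using hA _ b⁻¹ h, hA ω b⟩
  have hshift : ∀ b', uniformMeasure (ι → B) (A ∩ {ω | ω i = b'})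
      = uniformMeasure (ι → B) (A ∩ {ω | ω i = b}) := by
    intro b'
    rw [← uniformMeasure_preimage (Equiv.mulRight (Pi.mulSingle i (b'⁻¹ * b)))
      (A ∩ {ω | ω i = b})]
    congr 1
    ext ω
    simp only [Set.mem_inter_iff, Set.mem_ofPred_eq, Set.mem_preimage, Equiv.coe_mulRight, hA',
      Pi.mul_apply, Pi.mulSingle_eq_same]
    refine and_congr_right fun _ => ⟨fun h => by simp [h], fun h => ?_⟩
    have := congrArg (· * b⁻¹ * b') h
    simpa [mul_assoc] using this
  have hsum : uniformMeasure (ι → B) A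
      = ∑ b' : B, uniformMeasure (ι → B) (A ∩ {ω | ω i = b'}) := by
    rw [← measure_biUnion_finset]
    · congr 1
      ext ω
      simp
    · intro b₁ _ b₂ _ hne
      refine Set.disjoint_left.2 fun ω h₁ h₂ => hne (h₁.2.symm.trans h₂.2)
    · exact fun _ _ => trivial
  rw [hsum]
  simp only [hshift, Finset.sum_const, Finset.card_univ, nsmul_eq_mul, PMF.uniformOfFintype_apply]
  rw [mul_comm, ← mul_assoc, ENNReal.inv_mul_cancel, one_mul]
  · simp
  · simp

/-- The common core of both Markov properties. The event `A` fixes the present history `l` and does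
not depend on the noise coordinate read at the next step. -/
theorem uniformMeasure_noisePath_succ (c : ℕ → Bool) (t : ℤ) (A : Set (Bool × Fin T → B))
    (l l' : List B) (hAl : ∀ ω ∈ A, noisePath c (clampTime T t) ω = l)
    (hA : ∀ m : Fin T, (m : ℤ) = t → ∀ ω b, ω ∈ A → ω * Pi.mulSingle (c m, m) b ∈ A) :
    uniformMeasure (Bool × Fin T → B) (A ∩ {ω | noisePath c (clampTime T (t + 1)) ω = l'})
      = uniformMeasure (Bool × Fin T → B) A * appendKernel B T t l l' := by
  classical
  let _ : MeasurableSpace (Bool × Fin T → B) := ⊤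
  unfold appendKernel
  split_ifs with ht
  · obtain ⟨m, rfl⟩ : ∃ m : Fin T, (m : ℤ) = t := by
      refine ⟨⟨t.toNat, by omega⟩, ?_⟩
      simp; omega
    have hm : clampTime T (m : ℤ) = m := by have := m.2; simp only [clampTime]; omega
    have hm' : clampTime T ((m : ℤ) + 1) = m + 1 := by have := m.2; simp only [clampTime]; omega
    have hset : A ∩ {ω | noisePath c (clampTime T ((m : ℤ) + 1)) ω = l'}
        = ⋃ b ∈ Finset.univ.filter (fun b : B => l' = l ++ [b]), A ∩ {ω | ω (c m, m) = b} := by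
      ext ω
      simp only [Set.mem_inter_iff, Set.mem_ofPred_eq, Set.mem_iUnion, Finset.mem_filter,
        Finset.mem_univ, true_and, exists_prop, hm', noisePath_succ]
      constructor
      · rintro ⟨h1, h2⟩
        have h3 := hAl ω h1
        rw [hm] at h3
        rw [h3] at h2
        exact ⟨ω (c m, m), by rw [← h2]; simp [noiseSeq], h1, rfl⟩
      · rintro ⟨b, rfl, h1, rfl⟩
        have h3 := hAl ω h1
        rw [hm] at h3
        exact ⟨h1, by rw [h3]; simp [noiseSeq]⟩
    rw [hset, measure_biUnion_finset]
    · simp only [uniformMeasure_inter_coord (c m, m) A (hA m rfl), PMF.map_apply, tsum_fintype]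
      rw [← Finset.mul_sum, Finset.sum_filter]
      exact congrArg _ (Finset.sum_congr rfl fun _ _ => by congr)
    · intro b₁ _ b₂ _ hne
      refine Set.disjoint_left.2 fun ω h₁ h₂ => hne (h₁.2.symm.trans h₂.2)
    · exact fun _ _ => trivial
  · have hcl : clampTime T (t + 1) = clampTime T t := by
      unfold clampTime; omega
    rw [hcl, PMF.pure_apply]
    split_ifs with hl
    · rw [mul_one]
      congr 1
      refine Set.inter_eq_left.2 fun ω hω => ?_
      rw [hl]; exact hAl ω hω
    · rw [mul_zero]
      convert measure_empty
      · refine Set.eq_empty_iff_forall_notMem.2 fun ω hω => hl ?_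
        rw [← hAl ω hω.1, ← hω.2]
      · infer_instance

theorem isMarkovChain_noisePath :
    @IsMarkovChain _ (List B) ⊤ (uniformMeasure (Bool × Fin T → B)) (appendKernel B T)
      (fun t => noisePath (fun _ => false) (clampTime T t)) := by
  let _ : MeasurableSpace (Bool × Fin T → B) := ⊤
  refine ⟨fun _ _ => trivial, fun r t hrt v => ?_⟩
  rw [← uniformMeasure_noisePath_succ (fun _ => false) t]
  · congr 1
    ext ω
    simp only [Set.mem_ofPred_eq, Set.mem_inter_iff, Set.mem_Icc]
    refine ⟨fun h => ⟨fun u hu => h u ⟨hu.1, by omega⟩, h _ ⟨by omega, le_rfl⟩⟩,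
      fun h u hu => ?_⟩
    rcases eq_or_ne u (t + 1) with rfl | hne
    · exact h.2
    · exact h.1 u ⟨hu.1, by omega⟩
  · exact fun ω hω => hω t ⟨hrt, le_rfl⟩
  -- Histories up to time `t` read only indices below `t`, so they do not see the coordinate of
  -- index `t`.
  · rintro m rfl ω b hω u hu
    rw [← hω u hu]
    refine noisePath_congr fun i hi => noiseSeq_mul_mulSingle _ _ _ _ _ _ ?_
    have := hu.2
    simp only [clampTime] at hi
    simp only [ne_eq, Prod.mk.injEq, true_and]
    omega

theorem isBranchedCopy_noisePath (s : ℤ) :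
    @IsBranchedCopy _ (List B) ⊤ (uniformMeasure (Bool × Fin T → B)) (appendKernel B T)
      (fun t => noisePath (fun _ => false) (clampTime T t)) s
      (fun t => noisePath (branchSelector s) (clampTime T t)) := by
  let _ : MeasurableSpace (Bool × Fin T → B) := ⊤
  refine ⟨fun _ _ => trivial, fun t ht => ?_, fun r q t hst v w => ?_⟩
  · funext ω
    refine noisePath_congr fun i hi => ?_
    have : branchSelector s i = false := by
      simp only [clampTime] at hi
      simp only [branchSelector, decide_eq_false_iff_not]
      omega
    simp [noiseSeq, this]
  rw [← uniformMeasure_noisePath_succ (branchSelector s) t]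
  · congr 1
    ext ω
    simp only [Set.mem_ofPred_eq, Set.mem_inter_iff, Set.mem_Icc, and_assoc]
    refine and_congr_right fun _ => ⟨fun h => ⟨fun u hu => h u ⟨hu.1, by omega⟩,
      h _ ⟨by omega, le_rfl⟩⟩, fun h u hu => ?_⟩
    rcases eq_or_ne u (t + 1) with rfl | hne
    · exact h.2
    · exact h.1 u ⟨hu.1, by omega⟩
  · exact fun ω hω => hω.2 t ⟨hst, le_rfl⟩
  -- The copy reads `(true, t)` next. The chain never reads the second copy of the noise, whatever
  -- its time, and the branched history up to `t` reads only indices below `t`.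
  · rintro m rfl ω b ⟨hω₁, hω₂⟩
    have hm : branchSelector s m = true := by simpa [branchSelector] using hst
    rw [hm]
    refine ⟨fun u hu => ?_, fun u hu => ?_⟩
    · rw [← hω₁ u hu]
      refine noisePath_congr fun i hi => noiseSeq_mul_mulSingle _ _ _ _ _ _ ?_
      simp
    · rw [← hω₂ u hu]
      refine noisePath_congr fun i hi => noiseSeq_mul_mulSingle _ _ _ _ _ _ ?_
      have := hu.2
      simp only [clampTime] at hi
      simp only [ne_eq, Prod.mk.injEq, not_and]
      omega

/-- Markov convexity, applied to a process `F` that is adapted to a finite sequence of independent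
uniformly distributed random variables. -/
theorem IsMarkovConvexDist.exists_adapted_bound {X : Type*} {d : X → X → ℝ≥0∞} {p : ℝ}
    (hp : 0 < p) (hd : ∀ x, d x x = 0) (h : IsMarkovConvexDist d p) :
    ∃ K : ℝ≥0, ∀ (B : Type) [Group B] [Fintype B] (T : ℕ) (F : ℕ → (ℕ → B) → X),
      (∀ m v w, (∀ i < m, v i = w i) → F m v = F m w) → ∀ I J : Finset ℕ, (∀ t ∈ J, t ≤ T) →
      ∑ k ∈ I, ∑ t ∈ J,
          (∑ ω : Bool × Fin T → B, d (F t (noiseSeq (fun _ => false) ω))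
            (F t (noiseSeq (branchSelector ((t : ℤ) - 2 ^ k)) ω)) ^ p)
              / (2 : ℝ≥0∞) ^ ((k : ℝ) * p)
        ≤ (K : ℝ≥0∞) ^ p * ∑ m ∈ Finset.range T, ∑ ω : Bool × Fin T → B,
            d (F (m + 1) (noiseSeq (fun _ => false) ω)) (F m (noiseSeq (fun _ => false) ω)) ^ p := by
  classical
  obtain ⟨K, -, hK⟩ := h
  refine ⟨K, fun B _ _ T F hF I J hJ => ?_⟩
  let _ : MeasurableSpace (Bool × Fin T → B) := ⊤
  have : IsProbabilityMeasure (uniformMeasure (Bool × Fin T → B)) := by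
    unfold uniformMeasure; infer_instance
  have : Countable (List B) := inferInstance
  have key := hK (List B) (Bool × Fin T → B) (uniformMeasure _) (appendKernel B T)
    (fun t => noisePath (fun _ => false) (clampTime T t))
    (fun s t => noisePath (branchSelector s) (clampTime T t))
    isMarkovChain_noisePath isBranchedCopy_noisePath
    -- A state is the whole history, so its length is the time and any adapted process is a function
    -- of the state. The default `1` is never seen, as `F m` depends only on the first `m` terms.
    (fun l => F l.length (fun i => l.getD i 1))
  have hf : ∀ (c : ℕ → Bool) (m : ℕ) (ω : Bool × Fin T → B),
      F (noisePath c m ω).length (fun i => (noisePath c m ω).getD i 1) = F m (noiseSeq c ω) := by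
    intro c m ω
    have hl : (noisePath c m ω).length = m := by simp [noisePath]
    rw [hl]
    refine hF _ _ _ fun i hi => ?_
    simp [noisePath, List.getD, hi]
  simp only [hf, lintegral_uniformMeasure] at key
  set M : ℝ≥0∞ := (Fintype.card (Bool × Fin T → B) : ℝ≥0∞) with hM
  have hM0 : M ≠ 0 := by simp [hM]
  have hMt : M ≠ ⊤ := by simp [hM]
  have hR : ∑' t : ℤ, (∑ ω : Bool × Fin T → B,
      d (F (clampTime T t) (noiseSeq (fun _ => false) ω))
        (F (clampTime T (t - 1)) (noiseSeq (fun _ => false) ω)) ^ p) / M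
      = (∑ m ∈ Finset.range T, ∑ ω : Bool × Fin T → B,
            d (F (m + 1) (noiseSeq (fun _ => false) ω))
              (F m (noiseSeq (fun _ => false) ω)) ^ p) / M := by
    -- Outside the times `1, …, T` the clamped process stands still and contributes `d x x = 0`.
    rw [tsum_eq_sum (s := (Finset.range T).image fun m : ℕ => (m : ℤ) + 1)]
    · rw [Finset.sum_image (by intro a _ b _ hab; simpa using hab)]
      simp only [div_eq_mul_inv]
      rw [Finset.sum_mul]
      refine Finset.sum_congr rfl fun m hm => ?_
      rw [Finset.mem_range] at hm
      have h1 : clampTime T ((m : ℤ) + 1) = m + 1 := by simp [clampTime]; omega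
      have h2 : clampTime T ((m : ℤ) + 1 - 1) = m := by simp [clampTime]; omega
      rw [h1, h2]
    · intro t ht
      have : clampTime T (t - 1) = clampTime T t := by
        by_contra hne
        apply ht
        simp only [clampTime] at hne
        simp only [Finset.mem_image, Finset.mem_range]
        exact ⟨(t - 1).toNat, by omega, by omega⟩
      simp [this, hd, hp]
  rw [hR] at key
  have hL : (∑ k ∈ I, ∑ t ∈ J,
          (∑ ω : Bool × Fin T → B, d (F t (noiseSeq (fun _ => false) ω))
            (F t (noiseSeq (branchSelector ((t : ℤ) - 2 ^ k)) ω)) ^ p)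
              / (2 : ℝ≥0∞) ^ ((k : ℝ) * p)) / M
      ≤ (K : ℝ≥0∞) ^ p * ((∑ m ∈ Finset.range T, ∑ ω : Bool × Fin T → B,
            d (F (m + 1) (noiseSeq (fun _ => false) ω))
              (F m (noiseSeq (fun _ => false) ω)) ^ p) / M) := by
    refine le_trans ?_ key
    refine le_trans ?_ (ENNReal.sum_le_tsum I)
    simp only [div_eq_mul_inv]
    rw [Finset.sum_mul]
    refine Finset.sum_le_sum fun k _ => ?_
    refine le_trans ?_ (ENNReal.tsum_comp_le_tsum_of_injective (f := fun t : ℕ => (t : ℤ))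
      Nat.cast_injective _)
    refine le_trans ?_ (ENNReal.sum_le_tsum J)
    rw [Finset.sum_mul]
    refine Finset.sum_le_sum fun t ht => ?_
    have h1 : clampTime T (t : ℤ) = t := by have := hJ t ht; simp [clampTime]; omega
    rw [h1, mul_right_comm]
  rw [← mul_div_assoc] at hL
  rw [ENNReal.div_le_iff hM0 hMt, ENNReal.div_mul_cancel hM0 hMt] at hL
  exact hL

end RandomWalk

/-! ### Moments of sums of signs, and a lower bound by sign flipping -/

section Signs

theorem sum_eq_zero_of_perm_neg {S : Type*} [Fintype S] (e : Equiv.Perm S) (f : S → ℝ)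
    (h : ∀ ω, f (e ω) = -f ω) : ∑ ω, f ω = 0 := by
  have h1 : ∑ ω, f (e ω) = ∑ ω, f ω := Equiv.sum_comp e f
  simp only [h, Finset.sum_neg_distrib] at h1
  linarith

/-- The second and fourth moments of a sum of independent signs, the independence being expressed
by permutations `e j` of the sample space that flip the `j`-th sign only. -/
theorem sum_signs_moments {S ι : Type*} [Fintype S] [DecidableEq ι] (σ : ι → S → ℝ)
    (e : ι → Equiv.Perm S) (hσ : ∀ j ω, σ j ω ^ 2 = 1) (he : ∀ j ω, σ j (e j ω) = -σ j ω)
    (he' : ∀ i j ω, i ≠ j → σ i (e j ω) = σ i ω) (s : Finset ι) :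
    ∑ ω, (∑ j ∈ s, σ j ω) ^ 2 = s.card * Fintype.card S ∧
      ∑ ω, (∑ j ∈ s, σ j ω) ^ 4 ≤ 3 * (s.card : ℝ) ^ 2 * Fintype.card S := by
  induction s using Finset.induction_on with
  | empty => simp
  | insert a s ha ih =>
    obtain ⟨h2, h4⟩ := ih
    have hinv : ∀ ω, ∑ j ∈ s, σ j (e a ω) = ∑ j ∈ s, σ j ω := fun ω =>
      Finset.sum_congr rfl fun j hj => he' j a ω fun h => ha (h ▸ hj)
    have hodd1 : ∑ ω, (∑ j ∈ s, σ j ω) * σ a ω = 0 :=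
      sum_eq_zero_of_perm_neg (e a) _ fun ω => by rw [hinv, he]; ring
    have hodd3 : ∑ ω, (∑ j ∈ s, σ j ω) ^ 3 * σ a ω = 0 :=
      sum_eq_zero_of_perm_neg (e a) _ fun ω => by rw [hinv, he]; ring
    simp only [Finset.sum_insert ha, Finset.card_insert_of_notMem ha]
    have e2 : ∀ ω, (σ a ω + ∑ j ∈ s, σ j ω) ^ 2
        = 1 + 2 * ((∑ j ∈ s, σ j ω) * σ a ω) + (∑ j ∈ s, σ j ω) ^ 2 := fun ω => by
      linear_combination hσ a ω
    have e4 : ∀ ω, (σ a ω + ∑ j ∈ s, σ j ω) ^ 4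
        = 1 + 4 * ((∑ j ∈ s, σ j ω) * σ a ω) + 6 * (∑ j ∈ s, σ j ω) ^ 2
          + 4 * ((∑ j ∈ s, σ j ω) ^ 3 * σ a ω) + (∑ j ∈ s, σ j ω) ^ 4 := fun ω => by
      linear_combination (σ a ω ^ 2 + 1 + 6 * (∑ j ∈ s, σ j ω) ^ 2
        + 4 * (∑ j ∈ s, σ j ω) * σ a ω) * hσ a ω
    simp only [e2, e4, Finset.sum_add_distrib, ← Finset.mul_sum, hodd1, hodd3, h2]
    simp only [Finset.sum_const, Finset.card_univ, nsmul_eq_mul, mul_one, mul_zero, add_zero]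
    push_cast
    constructor
    · ring
    -- With `N = s.card`: `1 + 6 N + 3 N² ≤ 3 (N + 1)²`.
    · nlinarith [h4, (Nat.cast_nonneg (Fintype.card S) : (0 : ℝ) ≤ _)]

/-- Two values at distance at least `2a` cannot both be less than `a` in absolute value; the sum
over `ω` is paired with its image under `e`. -/
theorem card_mul_rpow_le_two_mul_sum {S : Type*} [Fintype S] (e : Equiv.Perm S) (D : S → ℝ)
    {a q : ℝ} (hq : 0 ≤ q) (h : ∀ ω, 2 * a ≤ |D (e ω) - D ω|) :
    (Fintype.card S : ℝ≥0∞) * ENNReal.ofReal a ^ q ≤ 2 * ∑ ω, ENNReal.ofReal |D ω| ^ q := by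
  rw [two_mul]
  nth_rewrite 2 [← Equiv.sum_comp e]
  rw [← Finset.sum_add_distrib, ← nsmul_eq_mul, ← Finset.card_univ, ← Finset.sum_const]
  refine Finset.sum_le_sum fun ω _ => ?_
  have h1 := (h ω).trans (abs_sub _ _)
  rcases le_total a |D ω| with h2 | h2
  · exact le_add_right (ENNReal.rpow_le_rpow (ENNReal.ofReal_le_ofReal h2) hq)
  · exact le_add_left (ENNReal.rpow_le_rpow (ENNReal.ofReal_le_ofReal (by linarith)) hq)

end Signs

/-! ### The multiscale walk: slope, height and area -/

section SignWalk

variable {n : ℕ}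

/-- The normalised sum over `j < n` of the signs attached to the dyadic blocks of length `2 ^ j`
that contain `u`; `v i j` is the sign of the block of length `2 ^ j` that starts at `i`. -/
noncomputable def dyadicSlope (v : ℕ → Fin n → ℤˣ) (u : ℕ) : ℝ :=
  (√n)⁻¹ * ∑ j : Fin n, (((v (2 ^ (j : ℕ) * (u / 2 ^ (j : ℕ))) j : ℤˣ) : ℤ) : ℝ)

/-- The height at time `m` of the walk whose steps are the dyadic slopes. -/
noncomputable def dyadicHeight (v : ℕ → Fin n → ℤˣ) (m : ℕ) : ℝ :=
  ∑ u ∈ Finset.range m, dyadicSlope v u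

/-- The area below the interpolated graph of `dyadicHeight v` on `[0, m]`. -/
noncomputable def dyadicArea (v : ℕ → Fin n → ℤˣ) (m : ℕ) : ℝ :=
  ∑ u ∈ Finset.range m, ((m : ℝ) - u - 1 / 2) * dyadicSlope v u

/-- The sign of a block is stored at its starting time, which makes the walk adapted. -/
theorem dyadicSlope_congr {v w : ℕ → Fin n → ℤˣ} {u : ℕ} (h : ∀ i ≤ u, v i = w i) :
    dyadicSlope v u = dyadicSlope w u := by
  unfold dyadicSlope
  congr 1
  refine Finset.sum_congr rfl fun j _ => ?_
  rw [h _ (Nat.mul_div_le u _)]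

theorem dyadicHeight_congr {v w : ℕ → Fin n → ℤˣ} {m : ℕ} (h : ∀ i < m, v i = w i) :
    dyadicHeight v m = dyadicHeight w m :=
  Finset.sum_congr rfl fun _ hu =>
    dyadicSlope_congr fun i hi => h i (hi.trans_lt (Finset.mem_range.1 hu))

theorem dyadicArea_congr {v w : ℕ → Fin n → ℤˣ} {m : ℕ} (h : ∀ i < m, v i = w i) :
    dyadicArea v m = dyadicArea w m :=
  Finset.sum_congr rfl fun _ hu => by
    rw [dyadicSlope_congr fun i hi => h i (hi.trans_lt (Finset.mem_range.1 hu))]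

theorem dyadicHeight_succ (v : ℕ → Fin n → ℤˣ) (m : ℕ) :
    dyadicHeight v (m + 1) = dyadicHeight v m + dyadicSlope v m :=
  Finset.sum_range_succ _ _

theorem dyadicArea_succ (v : ℕ → Fin n → ℤˣ) (m : ℕ) :
    dyadicArea v (m + 1) = dyadicArea v m + dyadicHeight v m + dyadicSlope v m / 2 := by
  unfold dyadicArea dyadicHeight
  rw [Finset.sum_range_succ, ← Finset.sum_add_distrib]
  congr 1
  · refine Finset.sum_congr rfl fun u _ => ?_
    push_cast; ring
  · push_cast; ring

theorem dyadicSlope_flip (v : ℕ → Fin n → ℤˣ) (j : Fin n) (q u : ℕ) :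
    dyadicSlope (v * Pi.mulSingle (2 ^ (j : ℕ) * q) (Pi.mulSingle j (-1))) u - dyadicSlope v u
      = if u / 2 ^ (j : ℕ) = q then
          -2 * (√n)⁻¹ * (((v (2 ^ (j : ℕ) * q) j : ℤˣ) : ℤ) : ℝ) else 0 := by
  unfold dyadicSlope
  rw [← mul_sub, ← Finset.sum_sub_distrib, Finset.sum_eq_single j]
  · split_ifs with h
    · subst h
      simp only [Pi.mul_apply, Pi.mulSingle_eq_same]
      push_cast; ring
    · rw [Pi.mul_apply, Pi.mulSingle_eq_of_ne]
      · simp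
      · simpa using h
  · intro i _ hi
    have : (Pi.mulSingle (2 ^ (j : ℕ) * q) (Pi.mulSingle j (-1)) : ℕ → Fin n → ℤˣ)
        (2 ^ (i : ℕ) * (u / 2 ^ (i : ℕ))) i = 1 := by
      rw [Pi.mulSingle_apply]
      split_ifs
      · exact Pi.mulSingle_eq_of_ne hi _
      · rfl
    simp [Pi.mul_apply, this]
  · simp

/-- The worst case is a block ending exactly at `t`, where the weights sum to `(2^j)²/2`; an earlier
block only has larger weights. -/
theorem sum_dyadic_block_weights_ge {j q t : ℕ} (h : 2 ^ j * (q + 1) ≤ t) :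
    (4 : ℝ) ^ j / 2
      ≤ ∑ u ∈ Finset.range t, if u / 2 ^ j = q then (t : ℝ) - u - 1 / 2 else 0 := by
  have hsum : ∀ N : ℕ, ∑ i ∈ Finset.range N, ((N : ℝ) - i - 1 / 2) = (N : ℝ) ^ 2 / 2 := by
    intro N
    have : ∀ M : ℕ, ∑ i ∈ Finset.range M, ((N : ℝ) - i - 1 / 2) = M * N - (M : ℝ) ^ 2 / 2 := by
      intro M
      induction M with
      | zero => simp
      | succ M ih => rw [Finset.sum_range_succ, ih]; push_cast; ring
    rw [this]; ring
  have h4 : (4 : ℝ) ^ j = ((2 ^ j : ℕ) : ℝ) ^ 2 := by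
    push_cast; rw [← pow_mul, mul_comm, pow_mul]; norm_num
  have hpos : 0 < 2 ^ j := by positivity
  rw [h4, ← hsum, ← Finset.sum_filter]
  have hle : ∀ i ∈ Finset.range (2 ^ j), ((2 ^ j : ℕ) : ℝ) - i - 1 / 2
      ≤ (t : ℝ) - ((2 ^ j * q + i : ℕ) : ℝ) - 1 / 2 := by
    intro i _
    have : ((2 ^ j * (q + 1) : ℕ) : ℝ) ≤ t := by exact_mod_cast h
    push_cast at this ⊢
    linarith
  refine (Finset.sum_le_sum hle).trans ?_
  rw [← Finset.sum_image (s := Finset.range (2 ^ j)) (g := fun i => 2 ^ j * q + i)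
    (f := fun u : ℕ => (t : ℝ) - u - 1 / 2) (by intro a _ b _ hab; simpa using hab)]
  refine Finset.sum_le_sum_of_subset_of_nonneg ?_ ?_
  · intro u hu
    obtain ⟨i, hi, rfl⟩ := Finset.mem_image.1 hu
    rw [Finset.mem_range] at hi
    rw [Finset.mem_filter, Finset.mem_range]
    refine ⟨by rw [mul_add] at h; omega, ?_⟩
    rw [Nat.mul_add_div hpos, Nat.div_eq_of_lt hi, add_zero]
  · intro u hu _
    have : ((u + 1 : ℕ) : ℝ) ≤ t := by
      exact_mod_cast Finset.mem_range.1 (Finset.mem_filter.1 hu).1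
    push_cast at this
    linarith

theorem abs_dyadicArea_flip_sub_ge (v : ℕ → Fin n → ℤˣ) (j : Fin n) {q t : ℕ}
    (h : 2 ^ (j : ℕ) * (q + 1) ≤ t) :
    2 * ((√n)⁻¹ * 4 ^ (j : ℕ) / 2)
      ≤ |dyadicArea (v * Pi.mulSingle (2 ^ (j : ℕ) * q) (Pi.mulSingle j (-1))) t
          - dyadicArea v t| := by
  have hdiff : dyadicArea (v * Pi.mulSingle (2 ^ (j : ℕ) * q) (Pi.mulSingle j (-1))) t
      - dyadicArea v t = -2 * (√n)⁻¹ * (((v (2 ^ (j : ℕ) * q) j : ℤˣ) : ℤ) : ℝ)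
        * ∑ u ∈ Finset.range t, if u / 2 ^ (j : ℕ) = q then (t : ℝ) - u - 1 / 2 else 0 := by
    unfold dyadicArea
    rw [← Finset.sum_sub_distrib, Finset.mul_sum]
    refine Finset.sum_congr rfl fun u _ => ?_
    rw [← mul_sub, dyadicSlope_flip]
    split_ifs <;> ring
  have hsum := sum_dyadic_block_weights_ge h
  have hn : 0 ≤ (√(n : ℝ))⁻¹ := by positivity
  have hunit : |(((v (2 ^ (j : ℕ) * q) j : ℤˣ) : ℤ) : ℝ)| = 1 := by
    rcases Int.units_eq_one_or (v (2 ^ (j : ℕ) * q) j) with h | h <;> simp [h]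
  rw [hdiff, abs_mul, abs_mul, abs_mul, hunit, abs_of_nonneg hn]
  have := hsum.trans (le_abs_self _)
  have h2 := mul_le_mul_of_nonneg_left this hn
  norm_num
  linarith

theorem noiseSeq_mul_mulSingle_self {B : Type} [Group B] {T : ℕ} (c : ℕ → Bool)
    (ω : Bool × Fin T → B) (k : Fin T) (b : B) :
    noiseSeq c (ω * Pi.mulSingle (c k, k) b) = noiseSeq c ω * Pi.mulSingle (k : ℕ) b := by
  funext i
  rw [Pi.mul_apply]
  by_cases hi : i = k
  · subst hi
    simp [noiseSeq]
  · rw [Pi.mulSingle_eq_of_ne hi, mul_one]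
    exact noiseSeq_mul_mulSingle c ω i b _ k (by simp [hi])

theorem sum_dyadicSlope_pow_four_le {T : ℕ} (c : ℕ → Bool) {u : ℕ} (hu : u < T) :
    ∑ ω : Bool × Fin T → Fin n → ℤˣ, dyadicSlope (noiseSeq c ω) u ^ 4
      ≤ 3 * Fintype.card (Bool × Fin T → Fin n → ℤˣ) := by
  have hlt : ∀ j : Fin n, 2 ^ (j : ℕ) * (u / 2 ^ (j : ℕ)) < T :=
    fun j => (Nat.mul_div_le u _).trans_lt hu
  have hm := (sum_signs_moments (S := Bool × Fin T → Fin n → ℤˣ)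
    (fun (j : Fin n) ω => (((noiseSeq c ω (2 ^ (j : ℕ) * (u / 2 ^ (j : ℕ))) j : ℤˣ) : ℤ) : ℝ))
    (fun j => Equiv.mulRight (Pi.mulSingle (c (2 ^ (j : ℕ) * (u / 2 ^ (j : ℕ))), ⟨_, hlt j⟩)
      (Pi.mulSingle j (-1)))) ?_ ?_ ?_ Finset.univ).2
  · simp only [dyadicSlope, mul_pow]
    rw [← Finset.mul_sum]
    rw [Finset.card_univ, Fintype.card_fin] at hm
    rcases Nat.eq_zero_or_pos n with rfl | hn
    · simp
    have hn' : (0 : ℝ) < n := by exact_mod_cast hn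
    -- The normalisation cancels exactly the factor `n²` in the fourth-moment bound.
    have h4 : (√(n : ℝ))⁻¹ ^ 4 = ((n : ℝ) ^ 2)⁻¹ := by
      rw [inv_pow, show 4 = 2 * 2 by norm_num, pow_mul, Real.sq_sqrt hn'.le]
    rw [h4, inv_mul_le_iff₀ (by positivity)]
    linarith
  · intro j ω
    rcases Int.units_eq_one_or (noiseSeq c ω (2 ^ (j : ℕ) * (u / 2 ^ (j : ℕ))) j) with h | h <;>
      simp [h]
  · intro j ω
    have := noiseSeq_mul_mulSingle_self c ω ⟨_, hlt j⟩ (Pi.mulSingle j (-1))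
    simp only at this
    simp [this]
  · intro i j ω hij
    have := noiseSeq_mul_mulSingle_self c ω ⟨_, hlt j⟩ (Pi.mulSingle j (-1))
    simp only at this
    rw [Equiv.coe_mulRight, this, Pi.mul_apply, Pi.mul_apply, Pi.mulSingle_apply]
    split_ifs
    · simp [Pi.mulSingle_eq_of_ne hij]
    · simp

end SignWalk

/-! ### The lifted walk in the Heisenberg group and failure of Markov convexity -/

namespace Heisenberg

variable {E : Type*} [NormedAddCommGroup E] [InnerProductSpace ℝ E] {n : ℕ}

/-- The horizontal lift of the graph of `dyadicHeight v`, in the plane spanned by `(e, 0)` and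
`(0, e)`. -/
noncomputable def dyadicWalk (e : E) (m : ℕ) (v : ℕ → Fin n → ℤˣ) : Heisenberg E :=
  ⟨(m : ℝ) • e, dyadicHeight v m • e, m * dyadicHeight v m / 2 - dyadicArea v m⟩

theorem dyadicWalk_congr (e : E) {m : ℕ} {v w : ℕ → Fin n → ℤˣ} (h : ∀ i < m, v i = w i) :
    dyadicWalk e m v = dyadicWalk e m w := by
  unfold dyadicWalk
  rw [dyadicHeight_congr h, dyadicArea_congr h]

theorem dyadicWalk_succ {e : E} (he : ‖e‖ = 1) (m : ℕ) (v : ℕ → Fin n → ℤˣ) :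
    dyadicWalk e (m + 1) v = dyadicWalk e m v * ⟨e, dyadicSlope v m • e, 0⟩ := by
  ext
  · simp [dyadicWalk, add_smul]
  · simp [dyadicWalk, add_smul, dyadicHeight_succ]
  · simp only [dyadicWalk, mul_z, real_inner_smul_left, real_inner_smul_right,
      real_inner_self_eq_norm_sq, he, dyadicHeight_succ, dyadicArea_succ]
    push_cast; ring

/-- Both points have the same first coordinate `m • e`, so the symplectic term cancels the height
parts of the `z`-coordinates and only the areas survive. -/
theorem inv_dyadicWalk_mul_z {e : E} (he : ‖e‖ = 1) (m : ℕ) (v w : ℕ → Fin n → ℤˣ) :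
    ((dyadicWalk e m v)⁻¹ * dyadicWalk e m w).z = dyadicArea v m - dyadicArea w m := by
  simp only [dyadicWalk, mul_z, inv_x, inv_y, inv_z, inner_neg_left, inner_neg_right,
    real_inner_smul_left, real_inner_smul_right, real_inner_self_eq_norm_sq, he]
  ring

variable {d : Heisenberg E → Heisenberg E → ℝ≥0∞} {p : ℝ} {e : E}

theorem sum_dist_step_le (he : ‖e‖ = 1) (hp₀ : 0 < p) (hp : p < 4)
    (hs : ∀ (g : Heisenberg E) (a : ℝ), d (g * ⟨e, a • e, 0⟩) g ≤ ENNReal.ofReal (√(1 + a ^ 2)))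
    {T m : ℕ} (hm : m < T) (c : ℕ → Bool) :
    ∑ ω : Bool × Fin T → Fin n → ℤˣ,
        d (dyadicWalk e (m + 1) (noiseSeq c ω)) (dyadicWalk e m (noiseSeq c ω)) ^ p
      ≤ 8 * Fintype.card (Bool × Fin T → Fin n → ℤˣ) := by
  have hstep : ∀ ω : Bool × Fin T → Fin n → ℤˣ,
      d (dyadicWalk e (m + 1) (noiseSeq c ω)) (dyadicWalk e m (noiseSeq c ω)) ^ p
        ≤ ENNReal.ofReal (2 + 2 * dyadicSlope (noiseSeq c ω) m ^ 4) := by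
    intro ω
    rw [dyadicWalk_succ he]
    set a := dyadicSlope (noiseSeq c ω) m
    have h1 : 1 ≤ √(1 + a ^ 2) := Real.one_le_sqrt.2 (by nlinarith [sq_nonneg a])
    refine (ENNReal.rpow_le_rpow (hs _ a) hp₀.le).trans ?_
    rw [ENNReal.ofReal_rpow_of_nonneg (by positivity) hp₀.le]
    -- The base is at least `1`, so the exponent `p` may be raised to `4`; then `(1 + a²)² ≤ 2 +
    -- 2a⁴`, whose mean is at most `2 + 2 · 3 = 8`.
    refine ENNReal.ofReal_le_ofReal ((Real.rpow_le_rpow_of_exponent_le h1 hp.le).trans ?_)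
    have : √(1 + a ^ 2) ^ (4 : ℝ) = (1 + a ^ 2) ^ 2 := by
      rw [show (4 : ℝ) = (4 : ℕ) by norm_num, Real.rpow_natCast, show 4 = 2 * 2 by norm_num,
        pow_mul, Real.sq_sqrt (by positivity)]
    rw [this]
    nlinarith [sq_nonneg (1 - a ^ 2)]
  refine (Finset.sum_le_sum fun ω _ => hstep ω).trans ?_
  rw [← ENNReal.ofReal_sum_of_nonneg fun ω _ => by positivity]
  have h8 : (8 : ℝ≥0∞) * Fintype.card (Bool × Fin T → Fin n → ℤˣ)
      = ENNReal.ofReal (8 * Fintype.card (Bool × Fin T → Fin n → ℤˣ)) := by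
    rw [ENNReal.ofReal_mul (by norm_num), ENNReal.ofReal_natCast]; simp
  rw [h8]
  refine ENNReal.ofReal_le_ofReal ?_
  rw [Finset.sum_add_distrib, ← Finset.mul_sum]
  have := sum_dyadicSlope_pow_four_le (n := n) c hm
  simp only [Finset.sum_const, Finset.card_univ, nsmul_eq_mul]
  linarith

theorem card_mul_le_sum_dist_branch (he : ‖e‖ = 1) (hp₀ : 0 < p)
    (hz : ∀ g h : Heisenberg E, ENNReal.ofReal |(g⁻¹ * h).z| ≤ d g h ^ 2)
    {T t : ℕ} (j : Fin n) (ht : 2 ^ ((j : ℕ) + 1) ≤ t) (htT : t ≤ T) :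
    (Fintype.card (Bool × Fin T → Fin n → ℤˣ) : ℝ≥0∞)
        * ENNReal.ofReal ((√n)⁻¹ * 4 ^ (j : ℕ) / 2) ^ (p / 2)
      ≤ 2 * ∑ ω : Bool × Fin T → Fin n → ℤˣ, d (dyadicWalk e t (noiseSeq (fun _ => false) ω))
          (dyadicWalk e t (noiseSeq (branchSelector ((t : ℤ) - 2 ^ ((j : ℕ) + 1))) ω)) ^ p := by
  set c := branchSelector ((t : ℤ) - 2 ^ ((j : ℕ) + 1)) with hc
  have hpos : 0 < 2 ^ (j : ℕ) := by positivity
  have hdm := Nat.div_add_mod t (2 ^ (j : ℕ))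
  have hmod := Nat.mod_lt t hpos
  -- Block `q` is the last block of length `2^j` that is complete by time `t`. It starts no earlier
  -- than `t - 2^(j+1)`, so the branched copy reads its sign from the fresh noise.
  obtain ⟨q, hq⟩ : ∃ q, t / 2 ^ (j : ℕ) = q + 1 := by
    refine Nat.exists_eq_succ_of_ne_zero fun h => ?_
    rw [h, mul_zero] at hdm
    rw [pow_succ] at ht
    omega
  rw [hq] at hdm
  have hend : 2 ^ (j : ℕ) * (q + 1) ≤ t := by omega
  have hlt : 2 ^ (j : ℕ) * q < T := by rw [mul_add] at hend; omega
  have hcq : c (2 ^ (j : ℕ) * q) = true := by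
    rw [hc, branchSelector, decide_eq_true_eq, pow_succ]
    rw [mul_add] at hdm
    have h1 : t ≤ 2 ^ (j : ℕ) * q + 2 ^ (j : ℕ) * 2 := by omega
    have : (t : ℤ) ≤ ((2 ^ (j : ℕ) * q + 2 ^ (j : ℕ) * 2 : ℕ) : ℤ) := by exact_mod_cast h1
    push_cast at this ⊢
    linarith
  let k : Fin T := ⟨2 ^ (j : ℕ) * q, hlt⟩
  let b : Fin n → ℤˣ := Pi.mulSingle j (-1)
  let flip : Equiv.Perm (Bool × Fin T → Fin n → ℤˣ) := Equiv.mulRight (Pi.mulSingle (true, k) b)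
  let D : (Bool × Fin T → Fin n → ℤˣ) → ℝ := fun ω =>
    dyadicArea (noiseSeq (fun _ => false) ω) t - dyadicArea (noiseSeq c ω) t
  have hD : ∀ ω, 2 * ((√n)⁻¹ * 4 ^ (j : ℕ) / 2) ≤ |D (flip ω) - D ω| := by
    intro ω
    have h1 : noiseSeq (fun _ => false) (flip ω) = noiseSeq (fun _ => false) ω := by
      funext i
      exact noiseSeq_mul_mulSingle _ ω i b true k (by simp)
    have h2 : noiseSeq c (flip ω) = noiseSeq c ω * Pi.mulSingle (2 ^ (j : ℕ) * q) b := by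
      have := noiseSeq_mul_mulSingle_self c ω k b
      rw [show c k = true from hcq] at this
      exact this
    simp only [D, h1, h2]
    rw [sub_sub_sub_cancel_left, abs_sub_comm]
    exact abs_dyadicArea_flip_sub_ge _ j hend
  refine (card_mul_rpow_le_two_mul_sum flip D (by positivity) hD).trans ?_
  gcongr with ω
  have h3 := hz (dyadicWalk e t (noiseSeq (fun _ => false) ω)) (dyadicWalk e t (noiseSeq c ω))
  rw [inv_dyadicWalk_mul_z he] at h3
  refine (ENNReal.rpow_le_rpow h3 (by positivity)).trans_eq ?_
  rw [← ENNReal.rpow_natCast, ← ENNReal.rpow_mul]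
  congr 1
  push_cast; ring

theorem not_isMarkovConvexDist (he : ‖e‖ = 1) (hp₀ : 0 < p) (hp : p < 4)
    (hd : ∀ g, d g g = 0) (hz : ∀ g h : Heisenberg E, ENNReal.ofReal |(g⁻¹ * h).z| ≤ d g h ^ 2)
    (hs : ∀ (g : Heisenberg E) (a : ℝ), d (g * ⟨e, a • e, 0⟩) g ≤ ENNReal.ofReal (√(1 + a ^ 2))) :
    ¬ IsMarkovConvexDist d p := by
  intro hconv
  obtain ⟨K, hK⟩ := hconv.exists_adapted_bound hp₀ hd
  have hbound : ∀ n : ℕ, 0 < n → (n : ℝ) ^ (1 - p / 4) ≤ 8 ^ (p / 2) * (32 * (K : ℝ) ^ p) := by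
    intro n hn
    have hn' : (0 : ℝ) < n := by exact_mod_cast hn
    -- Each noise term is a vector of `n` signs, one per scale. The times `t ≥ 2^n` satisfy `t ≥
    -- 2^(j+1)` for all `j < n`, and they are half of the total duration `2^(n+1)`. Scale `j` is
    -- tested with the branching delay `2^(j+1)`, hence the shift of the index set.
    have key := hK (Fin n → ℤˣ) (2 ^ (n + 1)) (fun m v => dyadicWalk e m v)
      (fun m v w h => dyadicWalk_congr e h) ((Finset.range n).image (· + 1))
      (Finset.Ico (2 ^ n) (2 ^ (n + 1))) (fun t ht => (Finset.mem_Ico.1 ht).2.le)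
    set M : ℝ≥0∞ := (Fintype.card (Bool × Fin (2 ^ (n + 1)) → Fin n → ℤˣ) : ℝ≥0∞) with hM
    have hM0 : M ≠ 0 := by simp [hM]
    have hMt : M ≠ ⊤ := by simp [hM]
    -- The `8` comes from `(4^j / 2) / 4^(j+1) = 1/8`, as `2^((j+1)p) = (4^(j+1))^(p/2)`.
    set c : ℝ≥0∞ := ENNReal.ofReal ((√n)⁻¹ / 8) ^ (p / 2) with hc
    have hterm : ∀ j ∈ Finset.range n, ∀ t ∈ Finset.Ico (2 ^ n) (2 ^ (n + 1)), M * c / 2 ≤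
        (∑ ω : Bool × Fin (2 ^ (n + 1)) → Fin n → ℤˣ,
          d (dyadicWalk e t (noiseSeq (fun _ => false) ω))
            (dyadicWalk e t (noiseSeq (branchSelector ((t : ℤ) - 2 ^ (j + 1))) ω)) ^ p)
              / (2 : ℝ≥0∞) ^ (((j + 1 : ℕ) : ℝ) * p) := by
      intro j hj t ht
      rw [Finset.mem_range] at hj
      rw [Finset.mem_Ico] at ht
      have h1 := card_mul_le_sum_dist_branch (T := 2 ^ (n + 1)) he hp₀ hz (⟨j, hj⟩ : Fin n)
        ((Nat.pow_le_pow_right (by norm_num) hj).trans ht.1) ht.2.le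
      have h2 : (2 : ℝ≥0∞) ^ (((j + 1 : ℕ) : ℝ) * p)
          = ENNReal.ofReal (4 ^ (j + 1)) ^ (p / 2) := by
        rw [show (4 : ℝ) ^ (j + 1) = 2 ^ (2 * ((j + 1 : ℕ) : ℝ)) by
          rw [Real.rpow_mul (by norm_num), Real.rpow_natCast]; norm_num,
          ← ENNReal.ofReal_rpow_of_pos (by norm_num), ← ENNReal.rpow_mul]
        congr 1
        · simp
        · ring
      have h3 : c = ENNReal.ofReal ((√n)⁻¹ * 4 ^ j / 2) ^ (p / 2)
          / (2 : ℝ≥0∞) ^ (((j + 1 : ℕ) : ℝ) * p) := by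
        rw [h2, ← ENNReal.div_rpow_of_nonneg _ _ (by positivity),
          ← ENNReal.ofReal_div_of_pos (by positivity), hc]
        congr 2
        field_simp
        ring
      rw [h3, ← mul_div_assoc, div_eq_mul_inv, mul_comm _ (2⁻¹ : ℝ≥0∞), ← mul_div_assoc]
      refine ENNReal.div_le_div_right ?_ _
      rw [mul_comm, ← div_eq_mul_inv]
      exact ENNReal.div_le_of_le_mul' h1
    have hL := Finset.sum_le_sum fun j hj => Finset.sum_le_sum (hterm j hj)
    rw [Finset.sum_image (by intro a _ b _ hab; simpa using hab)] at key
    have hR := Finset.sum_le_sum (s := Finset.range (2 ^ (n + 1))) fun m hm =>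
      sum_dist_step_le (n := n) he hp₀ hp hs (Finset.mem_range.1 hm) (fun _ => false)
    have hall := hL.trans (key.trans (mul_le_mul_right hR _))
    -- `32 = 2 · 2 · 8`: the loss in the flipping argument, the ratio of the duration to the number
    -- of times used, and the moment bound for a step.
    have hfin : (n : ℝ≥0∞) * c ≤ 32 * (K : ℝ≥0∞) ^ p := by
      simp only [Finset.sum_const, Finset.card_range, Nat.card_Ico, nsmul_eq_mul] at hall
      rw [show 2 ^ (n + 1) - 2 ^ n = 2 ^ n by rw [pow_succ]; omega] at hall
      rw [← hM] at hall
      have hA : (2 : ℝ≥0∞) ^ n * M ≠ 0 := by simp [hM0]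
      have hB : (2 : ℝ≥0∞) ^ n * M ≠ ⊤ := ENNReal.mul_ne_top (by simp) hMt
      rw [← ENNReal.mul_le_mul_iff_right hA hB]
      calc 2 ^ n * M * (n * c)
          = 2 * (n * ((2 ^ n : ℕ) * (M * c / 2))) := by
            push_cast
            rw [div_eq_mul_inv]
            calc 2 ^ n * M * (n * c) = 2 ^ n * M * (n * c) * (2 * 2⁻¹) := by
                  rw [ENNReal.mul_inv_cancel (by norm_num) (by norm_num), mul_one]
              _ = _ := by ring
        _ ≤ 2 * ((K : ℝ≥0∞) ^ p * ((2 ^ (n + 1) : ℕ) * (8 * M))) := mul_le_mul_right hall _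
        _ = 2 ^ n * M * (32 * (K : ℝ≥0∞) ^ p) := by push_cast; ring
    have hreal : (n : ℝ) * ((√n)⁻¹ / 8) ^ (p / 2) ≤ 32 * (K : ℝ) ^ p := by
      rw [hc, ENNReal.ofReal_rpow_of_nonneg (by positivity) (by positivity),
        ← ENNReal.ofReal_natCast, ← ENNReal.ofReal_mul (by positivity),
        ← ENNReal.ofReal_coe_nnreal, ENNReal.ofReal_rpow_of_nonneg (by positivity) hp₀.le,
        show (32 : ℝ≥0∞) = ENNReal.ofReal 32 by simp, ← ENNReal.ofReal_mul (by norm_num)] at hfin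
      exact (ENNReal.ofReal_le_ofReal_iff (by positivity)).1 hfin
    have hpow : (n : ℝ) ^ (1 - p / 4) = 8 ^ (p / 2) * (n * ((√n)⁻¹ / 8) ^ (p / 2)) := by
      rw [Real.div_rpow (by positivity) (by norm_num), Real.sqrt_eq_rpow,
        ← Real.rpow_neg hn'.le, ← Real.rpow_mul hn'.le]
      have h8 : (8 : ℝ) ^ (p / 2) ≠ 0 := by positivity
      field_simp
      nth_rewrite 2 [← Real.rpow_one (n : ℝ)]
      rw [← Real.rpow_add hn']
      congr 1
      ring
    rw [hpow]
    gcongr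
  have htend : Filter.Tendsto (fun n : ℕ => (n : ℝ) ^ (1 - p / 4)) Filter.atTop Filter.atTop :=
    (tendsto_rpow_atTop (by linarith)).comp tendsto_natCast_atTop_atTop
  obtain ⟨n, hn, hn0⟩ := ((htend.eventually_gt_atTop (8 ^ (p / 2) * (32 * (K : ℝ) ^ p))).and
    (Filter.eventually_gt_atTop 0)).exists
  exact absurd (hbound n hn0) (not_le.2 hn)

end Heisenberg

/-! ### The two metric properties for the Koranyi and Carnot–Carathéodory distances -/

theorem norm_sub_le_integral_of_norm_derivWithin_le {F : Type*} [NormedAddCommGroup F]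
    [NormedSpace ℝ F] [CompleteSpace F] {f : ℝ → F} {s : ℝ → ℝ} {a b t : ℝ} (hab : a < b)
    (hf : ContDiffOn ℝ 1 f (Set.Icc a b)) (hs : ContinuousOn s (Set.Icc a b))
    (hle : ∀ u ∈ Set.Icc a b, ‖derivWithin f (Set.Icc a b) u‖ ≤ s u) (ht : t ∈ Set.Icc a b) :
    ‖f t - f a‖ ≤ ∫ u in a..b, s u := by
  have hsub : Set.Icc a t ⊆ Set.Icc a b := Set.Icc_subset_Icc_right ht.2
  have hcont : ContinuousOn (derivWithin f (Set.Icc a b)) (Set.Icc a b) :=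
    hf.continuousOn_derivWithin (uniqueDiffOn_Icc hab) le_rfl
  have hint : IntervalIntegrable (derivWithin f (Set.Icc a b)) volume a t :=
    (hcont.mono hsub).intervalIntegrable_of_Icc ht.1
  have hst : IntervalIntegrable s volume a t := (hs.mono hsub).intervalIntegrable_of_Icc ht.1
  have hftc : ∫ u in a..t, derivWithin f (Set.Icc a b) u = f t - f a := by
    refine intervalIntegral.integral_eq_sub_of_hasDerivAt_of_le ht.1 (hf.continuousOn.mono hsub)
      (fun u hu => ?_) hint
    have hu' : u ∈ Set.Icc a b := ⟨hu.1.le, hu.2.le.trans ht.2⟩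
    exact ((hf.differentiableOn one_ne_zero u hu').hasDerivWithinAt).hasDerivAt
      (Icc_mem_nhds hu.1 (hu.2.trans_le ht.2))
  rw [← hftc]
  refine (intervalIntegral.norm_integral_le_integral_norm ht.1).trans ?_
  refine (intervalIntegral.integral_mono_on ht.1 hint.norm hst fun u hu => hle u (hsub hu)).trans ?_
  refine intervalIntegral.integral_mono_interval le_rfl ht.1 ht.2 ?_
    (hs.intervalIntegrable_of_Icc hab.le)
  refine (ae_restrict_iff' measurableSet_Ioc).2 (.of_forall fun u hu => ?_)
  exact (norm_nonneg _).trans (hle u (Set.Ioc_subset_Icc_self hu))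

namespace Heisenberg

variable {E : Type*} [NormedAddCommGroup E] [InnerProductSpace ℝ E]

theorem abs_inv_mul_z_le_edist_sq (g h : Heisenberg E) :
    ENNReal.ofReal |(g⁻¹ * h).z| ≤ edist g h ^ 2 := by
  rw [edist_dist, dist_def, ← ENNReal.ofReal_pow (koranyiNorm_nonneg _)]
  refine ENNReal.ofReal_le_ofReal (abs_le_of_sq_le_sq ?_ (by positivity))
  rw [← pow_mul, koranyiNorm_pow_four]
  nlinarith [sq_nonneg (‖(g⁻¹ * h).x‖ ^ 2 + ‖(g⁻¹ * h).y‖ ^ 2)]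

theorem edist_mul_horizontal_le {e : E} (he : ‖e‖ = 1) (g : Heisenberg E) (a : ℝ) :
    edist (g * ⟨e, a • e, 0⟩) g ≤ ENNReal.ofReal (√(1 + a ^ 2)) := by
  rw [edist_comm, edist_dist, dist_def, inv_mul_cancel_left]
  refine ENNReal.ofReal_le_ofReal ?_
  refine (pow_le_pow_iff_left₀ (koranyiNorm_nonneg _) (by positivity)
    (show 4 ≠ 0 by norm_num)).1 ?_
  rw [koranyiNorm_pow_four, show 4 = 2 * 2 by norm_num, pow_mul √_, Real.sq_sqrt (by positivity)]
  simp [norm_smul, he]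

/-- A crude isoperimetric inequality. After translating the start to the origin, horizontality makes
the derivative of `z` half the symplectic form of displacement and velocity. Each displacement
component is at most the length `L`, so `|z'|` is at most `L` times the speed. -/
theorem IsHorizontalCurve.abs_inv_mul_z_le [CompleteSpace E] {γ : ℝ → Heisenberg E} {a b : ℝ}
    (hab : a < b) (hγ : IsHorizontalCurve γ a b) :
    |((γ a)⁻¹ * γ b).z| ≤ horizontalLength γ a b ^ 2 := by
  set x' := derivWithin (fun s => (γ s).x) (Set.Icc a b) with hx'
  set y' := derivWithin (fun s => (γ s).y) (Set.Icc a b) with hy'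
  set s : ℝ → ℝ := fun t => √(‖x' t‖ ^ 2 + ‖y' t‖ ^ 2) with hs
  have hL : horizontalLength γ a b = ∫ t in a..b, s t := rfl
  have hud := uniqueDiffOn_Icc hab
  have hcx : ContinuousOn x' (Set.Icc a b) := hγ.contDiffOn_x.continuousOn_derivWithin hud le_rfl
  have hcy : ContinuousOn y' (Set.Icc a b) := hγ.contDiffOn_y.continuousOn_derivWithin hud le_rfl
  have hsc : ContinuousOn s (Set.Icc a b) := ((hcx.norm.pow 2).add (hcy.norm.pow 2)).sqrt
  have hxs : ∀ t, ‖x' t‖ ≤ s t := fun t => Real.le_sqrt_of_sq_le (by nlinarith [sq_nonneg ‖y' t‖])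
  have hys : ∀ t, ‖y' t‖ ≤ s t := fun t => Real.le_sqrt_of_sq_le (by nlinarith [sq_nonneg ‖x' t‖])
  have hX := fun t (ht : t ∈ Set.Icc a b) => norm_sub_le_integral_of_norm_derivWithin_le hab
    hγ.contDiffOn_x hsc (fun u _ => hxs u) ht
  have hY := fun t (ht : t ∈ Set.Icc a b) => norm_sub_le_integral_of_norm_derivWithin_le hab
    hγ.contDiffOn_y hsc (fun u _ => hys u) ht
  rw [← hL] at hX hY
  set L := horizontalLength γ a b
  have hw : ContDiffOn ℝ 1 (fun t => ((γ a)⁻¹ * γ t).z) (Set.Icc a b) := by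
    simp only [mul_z, inv_x, inv_y, inv_z]
    exact (contDiffOn_const.add hγ.contDiffOn_z).add (contDiffOn_const.mul
      ((contDiffOn_const.inner ℝ hγ.contDiffOn_y).sub
        (hγ.contDiffOn_x.inner ℝ contDiffOn_const)))
  have hdw : ∀ t ∈ Set.Icc a b, derivWithin (fun t => ((γ a)⁻¹ * γ t).z) (Set.Icc a b) t
      = (1 / 2) * (⟪(γ t).x - (γ a).x, y' t⟫ - ⟪x' t, (γ t).y - (γ a).y⟫) := by
    intro t ht
    have h1 := (hγ.contDiffOn_x.differentiableOn one_ne_zero t ht).hasDerivWithinAt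
    have h2 := (hγ.contDiffOn_y.differentiableOn one_ne_zero t ht).hasDerivWithinAt
    have h3 := (hγ.contDiffOn_z.differentiableOn one_ne_zero t ht).hasDerivWithinAt
    have h4 := (h3.const_add (-(γ a).z)).add
      ((((hasDerivWithinAt_const t (Set.Icc a b) (-(γ a).x)).inner ℝ h2).sub
        (h1.inner ℝ (hasDerivWithinAt_const t (Set.Icc a b) (-(γ a).y)))).const_mul (1 / 2))
    refine (h4.derivWithin (hud t ht)).trans ?_
    rw [hγ.horizontal t ht]
    simp only [← hx', ← hy', inner_neg_left, inner_neg_right, inner_sub_left, inner_sub_right,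
      inner_zero_left, inner_zero_right]
    ring
  have hfinal := norm_sub_le_integral_of_norm_derivWithin_le (s := fun t => L * s t) hab hw
    (continuousOn_const.mul hsc) (fun t ht => ?_) (Set.right_mem_Icc.2 hab.le)
  · rw [intervalIntegral.integral_const_mul, ← hL] at hfinal
    rw [sq]
    simpa using hfinal
  · rw [hdw t ht, Real.norm_eq_abs, abs_mul, abs_of_pos (by norm_num : (0 : ℝ) < 1 / 2)]
    have h1 := (abs_real_inner_le_norm ((γ t).x - (γ a).x) (y' t)).trans
      (mul_le_mul (hX t ht) (hys t) (norm_nonneg _) ((norm_nonneg _).trans (hX t ht)))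
    have h2 := (abs_real_inner_le_norm (x' t) ((γ t).y - (γ a).y)).trans
      (mul_le_mul (hxs t) (hY t ht) (norm_nonneg _) (Real.sqrt_nonneg _))
    have h3 := abs_sub ⟪(γ t).x - (γ a).x, y' t⟫ ⟪x' t, (γ t).y - (γ a).y⟫
    linarith

theorem horizontalLength_nonneg {γ : ℝ → Heisenberg E} {a b : ℝ} (hab : a ≤ b) :
    0 ≤ horizontalLength γ a b :=
  intervalIntegral.integral_nonneg hab fun _ _ => Real.sqrt_nonneg _

theorem abs_inv_mul_z_le_ccDist_sq [CompleteSpace E] (g h : Heisenberg E) :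
    ENNReal.ofReal |(g⁻¹ * h).z| ≤ ccDist g h ^ 2 := by
  have key : ENNReal.ofReal √|(g⁻¹ * h).z| ≤ ccDist g h := by
    refine le_iInf fun γ => le_iInf fun a => le_iInf fun b => le_iInf fun hab => le_iInf fun hγ =>
      le_iInf fun ha => le_iInf fun hb => ENNReal.ofReal_le_ofReal ?_
    subst ha hb
    exact Real.sqrt_le_iff.2 ⟨horizontalLength_nonneg hab.le, hγ.abs_inv_mul_z_le hab⟩
  calc ENNReal.ofReal |(g⁻¹ * h).z| = ENNReal.ofReal √|(g⁻¹ * h).z| ^ 2 := by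
        rw [← ENNReal.ofReal_pow (Real.sqrt_nonneg _), Real.sq_sqrt (abs_nonneg _)]
    _ ≤ ccDist g h ^ 2 := by gcongr

theorem ccDist_le_of_curve {γ : ℝ → Heisenberg E} {a b : ℝ} (hab : a < b)
    (hγ : IsHorizontalCurve γ a b) :
    ccDist (γ a) (γ b) ≤ ENNReal.ofReal (horizontalLength γ a b) :=
  iInf_le_of_le γ <| iInf_le_of_le a <| iInf_le_of_le b <| iInf_le_of_le hab <|
    iInf_le_of_le hγ <| iInf_le_of_le rfl <| iInf_le_of_le rfl le_rfl

theorem ccDist_self (g : Heisenberg E) : ccDist g g = 0 := by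
  have h := ccDist_le_of_curve (γ := fun _ => g) zero_lt_one
    ⟨contDiffOn_const, contDiffOn_const, contDiffOn_const, fun t _ => by simp⟩
  simpa [horizontalLength] using h

theorem ccDist_mul_horizontal_le {e : E} (he : ‖e‖ = 1) (g : Heisenberg E) (a : ℝ) :
    ccDist (g * ⟨e, a • e, 0⟩) g ≤ ENNReal.ofReal (√(1 + a ^ 2)) := by
  -- The translated straight segment, traversed backwards because the distance is taken from the new
  -- point to `g`.
  let γ : ℝ → Heisenberg E := fun t => g * ⟨(1 - t) • e, (1 - t) • a • e, 0⟩
  have hx : ∀ t, HasDerivAt (fun t => (γ t).x) (-e) t := fun t => by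
    have := (((hasDerivAt_id t).const_sub 1).smul_const e).const_add g.x
    simpa [γ] using this
  have hy : ∀ t, HasDerivAt (fun t => (γ t).y) (-(a • e)) t := fun t => by
    have := (((hasDerivAt_id t).const_sub 1).smul_const (a • e)).const_add g.y
    simpa [γ] using this
  set q : ℝ := (1 / 2) * (⟪g.x, a • e⟫ - ⟪e, g.y⟫) with hq
  have hzeq : (fun t => (γ t).z) = fun t => g.z + (1 - t) * q := by
    funext t
    simp only [γ, mul_z, real_inner_smul_left, inner_smul_right, hq]
    ring
  have hz : ∀ t, HasDerivAt (fun t => (γ t).z) (-q) t := fun t => by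
    rw [hzeq]
    have := (((hasDerivAt_id t).const_sub 1).mul_const q).const_add g.z
    simpa using this
  have hud := uniqueDiffOn_Icc (zero_lt_one' ℝ)
  have hxd : ∀ t ∈ Set.Icc (0 : ℝ) 1, derivWithin (fun t => (γ t).x) (Set.Icc 0 1) t = -e :=
    fun t ht => (hx t).hasDerivWithinAt.derivWithin (hud t ht)
  have hyd : ∀ t ∈ Set.Icc (0 : ℝ) 1, derivWithin (fun t => (γ t).y) (Set.Icc 0 1) t = -(a • e) :=
    fun t ht => (hy t).hasDerivWithinAt.derivWithin (hud t ht)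
  have hγ : IsHorizontalCurve γ 0 1 := by
    refine ⟨?_, ?_, ?_, fun t ht => ?_⟩
    · have : ContDiff ℝ 1 fun t : ℝ => g.x + (1 - t) • e := by fun_prop
      exact this.contDiffOn
    · have : ContDiff ℝ 1 fun t : ℝ => g.y + (1 - t) • a • e := by fun_prop
      exact this.contDiffOn
    · rw [hzeq]
      have : ContDiff ℝ 1 fun t : ℝ => g.z + (1 - t) * q := by fun_prop
      exact this.contDiffOn
    · rw [(hz t).hasDerivWithinAt.derivWithin (hud t ht), hxd t ht, hyd t ht]
      simp only [γ, mul_x, mul_y, inner_neg_left, inner_neg_right, inner_add_left, inner_add_right,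
        real_inner_smul_left, inner_smul_right, hq, real_inner_self_eq_norm_sq, he]
      ring
  have hlen : horizontalLength γ 0 1 = √(1 + a ^ 2) := by
    have : horizontalLength γ 0 1 = ∫ _ in (0 : ℝ)..1, √(1 + a ^ 2) := by
      refine intervalIntegral.integral_congr fun t ht => ?_
      rw [Set.uIcc_of_le zero_le_one] at ht
      simp only [hxd t ht, hyd t ht]
      simp [norm_smul, he]
    simpa using this
  have h := ccDist_le_of_curve zero_lt_one hγ
  rw [hlen] at h
  have h0 : γ 0 = g * ⟨e, a • e, 0⟩ := by simp [γ]
  have h1 : γ 1 = g := by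
    have : (⟨0, 0, 0⟩ : Heisenberg E) = 1 := rfl
    simp [γ, this]
  rwa [h0, h1] at h

theorem not_markovConvex {p : ℝ} {e : E} (he : ‖e‖ = 1) (hp₀ : 0 < p) (hp : p < 4) :
    ¬ MarkovConvex (Heisenberg E) p :=
  not_isMarkovConvexDist he hp₀ hp edist_self abs_inv_mul_z_le_edist_sq
    (edist_mul_horizontal_le he)

end Heisenberg

theorem corollary1p3 (p : ℝ) (hp₀ : 0 < p) (hp : p < 4) :
    ¬ MarkovConvex HeisenbergOne p ∧
      ¬ IsMarkovConvexDist (Heisenberg.ccDist : HeisenbergOne → HeisenbergOne → ℝ≥0∞) p ∧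
      ¬ MarkovConvex HeisenbergInfty p := by
  have he : ‖(EuclideanSpace.single 0 1 : EuclideanSpace ℝ (Fin 1))‖ = 1 := by simp
  refine ⟨Heisenberg.not_markovConvex he hp₀ hp, ?_, ?_⟩
  · exact Heisenberg.not_isMarkovConvexDist he hp₀ hp Heisenberg.ccDist_self
      Heisenberg.abs_inv_mul_z_le_ccDist_sq (Heisenberg.ccDist_mul_horizontal_le he)
  · refine Heisenberg.not_markovConvex (e := lp.single 2 0 (1 : ℝ)) ?_ hp₀ hp
    rw [lp.norm_single (by norm_num)]
    simp
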